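/- Let $\lambda>0$, $0<a\le R$, $P>0$, $\theta>0$ and $\alpha>2$. Let base stations be located at the random points $x_0,x_1,\dots$ of a Poisson point process in the plane $\mathbb R^2$ that has constant intensity $\lambda$ on $\{y:\|y\|\ge a\}$ and no point in $\{y:\|y\|<a\}$. Let the channel gains $g_0,g_1,\dots$ be independent copies of a random variable $G\ge 0$, independent of the points, where $\mathbb E[e^{-tG}]<\infty$ for all $t$ in a neighbourhood of $0$. Put $$X=\sum_{i:\,a\le\|x_i\|<R} g_i P\|x_i\|^{-\alpha},\qquad Y=\sum_{i:\,\|x_i\|\ge R} g_i P\|x_i\|^{-\alpha},\qquad \Omega=\theta Y-X .$$ Then both sums converge almost surely, and the cumulant generating function $\mathcal K_\Omega(t)=\log\mathbb E[e^{-t\Omega}]$ is finite and analytic near $t=0$. The cumulants $\kappa_n(\Omega)$ of $\Omega$, defined by the Taylor expansion $\mathcal K_\Omega(t)=\sum_{n}(-1)^n\kappa_n(\Omega)\,t^n/n!$ at $0$, satisfy, for every integer $n\ge 1$, $$\kappa_n(\Omega)=\kappa_n^{\lim}(\Omega)\left[1+\big((-\theta)^n-1\big)u^{-n\alpha+2}\right],\qquad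 u=\frac Ra,\qquad \kappa_n^{\lim}(\Omega)=(-1)^n\,\frac{2\pi\lambda\,\mu_n(G)\,P^n}{n\alpha-2}\,a^{-n\alpha+2},$$ where $\mu_n(G)=\mathbb E[G^n]$. -/

import Mathlib

open MeasureTheory ProbabilityTheory Filter Topology
open scoped NNReal ENNReal

namespace CoMP

/-- The two-dimensional plane with the Euclidean norm and Lebesgue measure. -/
abbrev Plane : Type := EuclideanSpace ℝ (Fin 2)

noncomputable section

/-- The counting measure of the points `y 0, y 1, ...`: the number of points in `B`,
with multiplicity, is `pointMeasure y B`. -/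
def pointMeasure {E : Type*} [MeasurableSpace E] (y : ℕ → E) : Measure E :=
  Measure.sum (fun i => Measure.dirac (y i))

/-- The random points `x 0, x 1, ...` form a Poisson point process with intensity measure
`Λ` : the number of points in a measurable set `B` with `Λ B < ∞` has the Poisson law with mean
`Λ B`, and the numbers of points in pairwise disjoint measurable sets are independent.
(As the points are indexed by `ℕ`, this concerns processes with infinitely many points, that is,
infinite intensity measures.) -/
structure IsPoissonPointProcess {S E : Type*} [MeasurableSpace S] [MeasurableSpace E]
    (Λ : Measure E) (x : ℕ → S → E) (μ : Measure S) : Prop where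
  measurable : ∀ i, Measurable (x i)
  hasLaw_count : ∀ B : Set E, MeasurableSet B → Λ B < ∞ →
    HasLaw (fun s => pointMeasure (fun i => x i s) B)
      ((poissonMeasure (Λ B).toNNReal).map (fun k : ℕ => (k : ℝ≥0∞))) μ
  indep_count : ∀ (m : ℕ) (B : Fin m → Set E), (∀ k, MeasurableSet (B k)) →
    Pairwise (fun k l => Disjoint (B k) (B l)) →
    iIndepFun (fun k s => pointMeasure (fun i => x i s) (B k)) μ

/-- Intensity measure of the base stations: constant density `lam` outside the exclusion region
`{r < a}`, and no base station inside it. -/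
def bsIntensity (lam a : ℝ) : Measure Plane :=
  ENNReal.ofReal lam • (volume : Measure Plane).restrict {y | a ≤ ‖y‖}

/-- The region of cooperation `{a ≤ r < R}`. -/
def coopRegion (a R : ℝ) : Set Plane := {y | a ≤ ‖y‖ ∧ ‖y‖ < R}

/-- The region of interference `{R ≤ r}`. -/
def interfRegion (R : ℝ) : Set Plane := {y | R ≤ ‖y‖}

/-- Power received at the origin from a base station at `y` with channel gain `g`, if `y` lies in
the region `B`, and `0` otherwise. -/
def receivedPower (B : Set Plane) (P α : ℝ) (g : ℝ) (y : Plane) : ℝ :=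
  B.indicator (fun z => g * P * ‖z‖ ^ (-α)) y

/-- Total power received at the origin from all base stations in the region `B`. -/
def aggregatePower {S : Type*} (B : Set Plane) (P α : ℝ) (x : ℕ → S → Plane) (g : ℕ → S → ℝ)
    (s : S) : ℝ :=
  ∑' i, receivedPower B P α (g i s) (x i s)

/-- The variable `Ω = θ Y - X`, where `X` is the useful signal power, received from the cooperating
base stations, and `Y` is the interference power. -/
def omegaVar {S : Type*} (a R P α θ : ℝ) (x : ℕ → S → Plane) (g : ℕ → S → ℝ) (s : S) : ℝ :=
  θ * aggregatePower (interfRegion R) P α x g s - aggregatePower (coopRegion a R) P α x g s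

/-- `𝓜_X(t) = 𝔼[exp(-t X)]`. -/
def MGF {S : Type*} [MeasurableSpace S] (X : S → ℝ) (μ : Measure S) (t : ℝ) : ℝ :=
  ∫ s, Real.exp (-t * X s) ∂μ

/-- `𝓚_X(t) = log 𝓜_X(t)`. -/
def CGF {S : Type*} [MeasurableSpace S] (X : S → ℝ) (μ : Measure S) (t : ℝ) : ℝ :=
  Real.log (MGF X μ t)

/-- The moment generating function of `X` is finite near `0`. -/
def HasCGF {S : Type*} [MeasurableSpace S] (X : S → ℝ) (μ : Measure S) : Prop :=
  ∀ᶠ t in 𝓝 (0 : ℝ), Integrable (fun s => Real.exp (-t * X s)) μ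

/-- The cumulants, that is, the numbers `κ_n` in the Taylor expansion
`𝓚_X(t) = ∑ (-1)^n κ_n t^n / n!` at `0`. -/
def cumulant {S : Type*} [MeasurableSpace S] (n : ℕ) (X : S → ℝ) (μ : Measure S) : ℝ :=
  (-1) ^ n * iteratedDeriv n (CGF X μ) 0

/-- `κ_n^lim`, where `m` stands for the `n`-th moment of the channel gain. -/
def kappaLim (n : ℕ) (lam P α a m : ℝ) : ℝ :=
  (-1) ^ n * (2 * Real.pi * lam * m * P ^ n / (n * α - 2)) * a ^ (-(n : ℝ) * α + 2)

end

end CoMP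

namespace CoMP

/-! Almost surely `Ω = ∑ g_i w(x_i)`, where the weight `w` (`omegaWeight`) is `θ P r^(-α)` in the
interference region and `-P r^(-α)` in the cooperation region. The exclusion radius `a > 0` makes
`w` bounded, and `α > 2` makes it integrable against the intensity `Λ`.

The core is the exponential functional `𝔼 exp(∑ g_i v(x_i)) = exp ∫ (M_G(v) - 1) dΛ`, with `M_G` the
moment generating function of the gain (`integral_exp_tsum_marked`). Without marks and for simple
functions it is a product of independent Poisson generating functions; approximation extends it to
bounded integrable functions (`integral_exp_tsum`). Conditionally on the points, a mark contributes
the factor `exp(cgf G (v(x_i)))`, so the marked case reduces to the unmarked one for `cgf G ∘ v`.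

With `v = -t w` the logarithm becomes `∫ (M_G(-t w) - 1) dΛ`. Termwise integration of the moment
series (`hasSum_integral_mgf_sub_one`) gives `κ_n(Ω) = μ_n(G) ∫ w^n dΛ` for `n ≥ 1`, and polar
coordinates evaluate the last integral. -/

/-! ### Auxiliary facts on integrals -/

/-- A consequence of Fatou's lemma. -/
lemma integrable_of_tendsto_of_integral_le {S : Type*} [MeasurableSpace S] {μ : Measure S}
    {f : ℕ → S → ℝ} {F : S → ℝ} {K : ℝ} (hf : ∀ n, Integrable (f n) μ)
    (hf_nonneg : ∀ n, 0 ≤ᵐ[μ] f n) (hK : ∀ n, ∫ s, f n s ∂μ ≤ K)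
    (hF : ∀ᵐ s ∂μ, Tendsto (fun n => f n s) atTop (𝓝 (F s))) : Integrable F μ := by
  have hmeas : AEStronglyMeasurable F μ :=
    aestronglyMeasurable_of_tendsto_ae atTop (fun n => (hf n).aestronglyMeasurable) hF
  refine ⟨hmeas, ?_⟩
  calc ∫⁻ s, ‖F s‖ₑ ∂μ = ∫⁻ s, liminf (fun n => ‖f n s‖ₑ) atTop ∂μ := by
        refine lintegral_congr_ae ?_
        filter_upwards [hF] with s hs
        exact ((continuous_enorm.tendsto _).comp hs).liminf_eq.symm
    _ ≤ liminf (fun n => ∫⁻ s, ‖f n s‖ₑ ∂μ) atTop :=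
        lintegral_liminf_le' fun n => (hf n).aestronglyMeasurable.enorm
    _ ≤ ENNReal.ofReal K := by
        refine liminf_le_of_frequently_le' (Frequently.of_forall fun n => ?_)
        rw [← ofReal_integral_norm_eq_lintegral_enorm (hf n)]
        refine ENNReal.ofReal_le_ofReal ?_
        rw [integral_congr_ae (g := f n)]
        · exact hK n
        · filter_upwards [hf_nonneg n] with s hs
          exact Real.norm_of_nonneg hs
    _ < ∞ := ENNReal.ofReal_lt_top

/-- Used for domination: if `φ` is bounded and integrable, then `exp φ - 1` is controlled by a
multiple of `|φ|`, even when the measure is infinite. -/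
lemma abs_exp_sub_one_le_mul_abs {z C : ℝ} (hz : |z| ≤ C) :
    |Real.exp z - 1| ≤ Real.exp C * |z| := by
  have h1 : |Real.exp z - 1| ≤ Real.exp |z| - 1 := by
    rcases le_total 0 z with h | h
    · rw [abs_of_nonneg h, abs_of_nonneg (by linarith [Real.add_one_le_exp z])]
    · rw [abs_of_nonpos h, abs_of_nonpos (by linarith [Real.exp_le_one_iff.2 h])]
      have h2 := Real.add_one_le_exp z
      have h3 := Real.add_one_le_exp (-z)
      linarith
  have h2 : Real.exp |z| - 1 ≤ |z| * Real.exp |z| := by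
    have h3 := Real.add_one_le_exp (-|z|)
    have h4 : Real.exp (-|z|) * Real.exp |z| = 1 := by rw [← Real.exp_add]; simp
    nlinarith [Real.exp_pos |z|]
  have h3 : Real.exp |z| ≤ Real.exp C := Real.exp_le_exp.2 hz
  nlinarith [abs_nonneg z]

lemma mgf_natCast_poissonMeasure (r : ℝ≥0) (t : ℝ) :
    mgf (fun k : ℕ => (k : ℝ)) (poissonMeasure r) t = Real.exp (r * (Real.exp t - 1)) := by
  rw [mgf, integral_poissonMeasure]
  calc ∑' n : ℕ, (Real.exp (-r) * r ^ n / (n.factorial : ℝ)) • Real.exp (t * n)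
      = ∑' n : ℕ, Real.exp (-r) * ((r * Real.exp t) ^ n / n.factorial) := by
        congr with n
        rw [mul_pow, ← Real.exp_nat_mul, smul_eq_mul]
        ring_nf
    _ = Real.exp (-r) * Real.exp (r * Real.exp t) := by
        rw [tsum_mul_left, (NormedSpace.expSeries_div_hasSum_exp ((r : ℝ) * Real.exp t)).tsum_eq,
          Real.exp_eq_exp_ℝ]
    _ = _ := by rw [← Real.exp_add]; ring_nf

lemma lintegral_natCast_poissonMeasure (r : ℝ≥0) :
    ∫⁻ k : ℕ, (k : ℝ≥0∞) ∂(poissonMeasure r) = r := by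
  have hs : HasSum (fun n : ℕ => Real.exp (-r) * r ^ n / (n.factorial : ℝ) * n) r := by
    -- The term at `0` vanishes, and the term at `n + 1` is `r` times the Poisson weight of `n`.
    rw [← hasSum_nat_add_iff' 1]
    convert! (hasSum_one_poissonMeasure r).mul_left (r : ℝ) using 1
    · funext n
      have h1 : ((n + 1 : ℕ) : ℝ) ≠ 0 := by positivity
      have h2 : (n.factorial : ℝ) ≠ 0 := by positivity
      rw [Nat.factorial_succ, pow_succ]
      push_cast at h1 ⊢
      field_simp
    · simp
  rw [poissonMeasure, lintegral_sum_measure]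
  simp_rw [lintegral_smul_measure, lintegral_dirac, smul_eq_mul]
  rw [← ENNReal.ofReal_coe_nnreal]
  refine Eq.trans ?_ (congrArg ENNReal.ofReal hs.tsum_eq)
  rw [ENNReal.ofReal_tsum_of_nonneg (fun n => by positivity) hs.summable]
  refine tsum_congr fun n => ?_
  rw [ENNReal.ofReal_mul (by positivity), ENNReal.ofReal_natCast]

/-! ### Poisson point processes -/

section Poisson

variable {S E : Type*} [MeasurableSpace S] [MeasurableSpace E] {Λ : Measure E}
  {x : ℕ → S → E} {μ : Measure S}

lemma pointMeasure_apply (y : ℕ → E) {B : Set E} (hB : MeasurableSet B) :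
    pointMeasure y B = ∑' i, B.indicator 1 (y i) := by
  rw [pointMeasure, Measure.sum_apply _ hB]
  exact tsum_congr fun i => Measure.dirac_apply' _ hB

lemma hasSum_indicator_pointMeasure {y : ℕ → E} {B : Set E} (hB : MeasurableSet B)
    (h : pointMeasure y B ≠ ∞) :
    HasSum (fun i => B.indicator (fun _ => (1 : ℝ)) (y i)) (pointMeasure y B).toReal := by
  rw [pointMeasure_apply y hB] at h ⊢
  have h1 := ENNReal.hasSum_toReal h
  rw [← ENNReal.tsum_toReal_eq (fun i => ENNReal.ne_top_of_tsum_ne_top h i)] at h1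
  refine h1.congr_fun fun i => ?_
  by_cases hi : y i ∈ B <;> simp [hi]

lemma IsPoissonPointProcess.measurable_count (hx : IsPoissonPointProcess Λ x μ) {B : Set E}
    (hB : MeasurableSet B) : Measurable fun s => pointMeasure (fun i => x i s) B := by
  simp_rw [pointMeasure_apply _ hB]
  exact Measurable.tsum fun i =>
    (measurable_one.indicator hB).comp (hx.measurable i)

lemma IsPoissonPointProcess.ae_count_ne_top (hx : IsPoissonPointProcess Λ x μ) {B : Set E}
    (hB : MeasurableSet B) (h : Λ B < ∞) :
    ∀ᵐ s ∂μ, pointMeasure (fun i => x i s) B ≠ ∞ := by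
  have hlaw := hx.hasLaw_count B hB h
  have hm : MeasurableSet {z : ℝ≥0∞ | z ≠ ∞} := (measurableSet_singleton _).compl
  refine (hlaw.ae_iff (p := fun z => z ≠ ∞) (measurableSet_setOfPred.1 hm)).2 ?_
  rw [ae_map_iff (by fun_prop) hm]
  exact Eventually.of_forall fun k => ENNReal.natCast_ne_top k

lemma IsPoissonPointProcess.lintegral_count (hx : IsPoissonPointProcess Λ x μ) {B : Set E}
    (hB : MeasurableSet B) (h : Λ B < ∞) :
    ∫⁻ s, pointMeasure (fun i => x i s) B ∂μ = Λ B := by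
  have h1 := (hx.hasLaw_count B hB h).lintegral_comp (f := fun z => z) (by fun_prop)
  rw [h1, lintegral_map (by fun_prop) (by fun_prop), lintegral_natCast_poissonMeasure,
    ENNReal.coe_toNNReal h.ne]

lemma IsPoissonPointProcess.mgf_count (hx : IsPoissonPointProcess Λ x μ) {B : Set E}
    (hB : MeasurableSet B) (h : Λ B < ∞) (t : ℝ) :
    mgf (fun s => (pointMeasure (fun i => x i s) B).toReal) μ t =
      Real.exp (Λ.real B * (Real.exp t - 1)) := by
  have h1 := (hx.hasLaw_count B hB h).integral_comp (f := fun z => Real.exp (t * z.toReal))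
    (by fun_prop)
  rw [integral_map (by fun_prop) (by fun_prop)] at h1
  have h2 := mgf_natCast_poissonMeasure (Λ B).toNNReal t
  rw [mgf] at h2 ⊢
  simp only [ENNReal.toReal_natCast, Function.comp_def] at h1
  rw [h1, h2]
  rfl

/-- On sets of finite intensity this is the mean of the Poisson law. Counts are prescribed only
there, so the general case follows by exhaustion with the spanning sets of `Λ`. -/
lemma IsPoissonPointProcess.sum_map_eq [SigmaFinite Λ] (hx : IsPoissonPointProcess Λ x μ) :
    Measure.sum (fun i => μ.map (x i)) = Λ := by
  have key : ∀ B, MeasurableSet B → Λ B < ∞ → Measure.sum (fun i => μ.map (x i)) B = Λ B := by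
    intro B hB h
    rw [← hx.lintegral_count hB h, Measure.sum_apply _ hB]
    simp_rw [pointMeasure_apply _ hB]
    rw [MeasureTheory.lintegral_tsum (f := fun i s => B.indicator 1 (x i s)) fun i =>
      ((measurable_one.indicator hB).comp (hx.measurable i)).aemeasurable]
    refine tsum_congr fun i => ?_
    rw [← lintegral_indicator_one hB, lintegral_map (measurable_one.indicator hB) (hx.measurable i)]
  refine Measure.ext fun B hB => ?_
  have hU : B = ⋃ n, B ∩ spanningSets Λ n := by
    rw [← Set.inter_iUnion, iUnion_spanningSets, Set.inter_univ]
  have hmono : Monotone fun n => B ∩ spanningSets Λ n := fun m n hmn =>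
    Set.inter_subset_inter_right _ (monotone_spanningSets Λ hmn)
  rw [hU, hmono.measure_iUnion, hmono.measure_iUnion]
  refine iSup_congr fun n => key _ (hB.inter (measurableSet_spanningSets Λ n)) ?_
  exact (measure_mono Set.inter_subset_right).trans_lt (measure_spanningSets_lt_top Λ n)

/-- Campbell's formula for the mean. -/
lemma IsPoissonPointProcess.lintegral_tsum [SigmaFinite Λ] (hx : IsPoissonPointProcess Λ x μ)
    {f : E → ℝ≥0∞} (hf : Measurable f) :
    ∑' i, ∫⁻ s, f (x i s) ∂μ = ∫⁻ y, f y ∂Λ := by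
  rw [← hx.sum_map_eq, lintegral_sum_measure]
  exact tsum_congr fun i => (lintegral_map hf (hx.measurable i)).symm

lemma IsPoissonPointProcess.ae_summable [SigmaFinite Λ] (hx : IsPoissonPointProcess Λ x μ)
    {φ : E → ℝ} (hm : Measurable φ) (hφ : Integrable φ Λ) :
    ∀ᵐ s ∂μ, Summable fun i => |φ (x i s)| := by
  have h : ∫⁻ s, ∑' i, ‖φ (x i s)‖ₑ ∂μ ≠ ∞ := by
    rw [MeasureTheory.lintegral_tsum (f := fun i s => ‖φ (x i s)‖ₑ) fun i => (hm.comp (hx.measurable i)).enorm.aemeasurable,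
      hx.lintegral_tsum (f := fun y => ‖φ y‖ₑ) hm.enorm]
    exact hφ.2.ne
  filter_upwards [ae_lt_top' (AEMeasurable.tsum fun i =>
    (hm.comp (hx.measurable i)).enorm.aemeasurable) h] with s hs
  have := ENNReal.summable_toReal hs.ne
  simpa using this

end Poisson

/-! ### Exponential functional without marks -/

section Poisson

variable {S E : Type*} [MeasurableSpace S] [MeasurableSpace E] {Λ : Measure E}
  {x : ℕ → S → E} {μ : Measure S}

/-- The level set of `0` may have infinite intensity, hence its exclusion. The cases of interest are
`h = id` (the sum over points) and `h = exp - 1` (the exponent). -/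
lemma simpleFunc_comp_eq_sum (φ : SimpleFunc E ℝ) {h : ℝ → ℝ} (h0 : h 0 = 0) (y : E) :
    h (φ y) = ∑ c ∈ φ.range.erase 0, h c * (φ ⁻¹' {c}).indicator (fun _ => (1 : ℝ)) y := by
  by_cases hy : φ y = 0
  · rw [hy, h0, Finset.sum_eq_zero]
    intro c hc
    have : y ∉ φ ⁻¹' {c} := fun h' => Finset.ne_of_mem_erase hc (by
      rw [← hy]; exact (Set.mem_singleton_iff.1 h').symm)
    simp [Set.indicator_of_notMem this]
  · rw [Finset.sum_eq_single (φ y)]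
    · rw [Set.indicator_of_mem (by simp), mul_one]
    · intro c _ hc
      have : y ∉ φ ⁻¹' {c} := fun h' => hc (Set.mem_singleton_iff.1 h').symm
      simp [Set.indicator_of_notMem this]
    · intro h'
      exact absurd (Finset.mem_erase.2 ⟨hy, φ.mem_range_self y⟩) h'

/-- The exponential functional of a Poisson point process, for simple functions. -/
lemma IsPoissonPointProcess.integral_exp_tsum_simpleFunc [IsProbabilityMeasure μ]
    (hx : IsPoissonPointProcess Λ x μ) (φ : SimpleFunc E ℝ)
    (hφ : ∀ c ≠ 0, Λ (φ ⁻¹' {c}) < ∞) :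
    Integrable (fun s => Real.exp (∑' i, φ (x i s))) μ ∧
    ∫ s, Real.exp (∑' i, φ (x i s)) ∂μ = Real.exp (∫ y, (Real.exp (φ y) - 1) ∂Λ) := by
  set T := φ.range.erase 0 with hT
  have hT0 : ∀ c : T, (c : ℝ) ≠ 0 := fun c => Finset.ne_of_mem_erase c.2
  have hB : ∀ c : ℝ, MeasurableSet (φ ⁻¹' {c}) := fun c => φ.measurableSet_preimage _
  let N : ℝ → S → ℝ := fun c s => (pointMeasure (fun i => x i s) (φ ⁻¹' {c})).toReal
  let X : T → S → ℝ := fun c s => c * N c s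
  have hX_meas : ∀ c, Measurable (X c) := fun c =>
    (hx.measurable_count (hB c)).ennreal_toReal.const_mul _
  have hX_indep : iIndepFun X μ := by
    have h1 := hx.indep_count T.card (fun k => φ ⁻¹' {(T.equivFin.symm k : ℝ)})
      (fun k => hB _) (fun k l hkl => by
        refine Disjoint.preimage _ (Set.disjoint_singleton.2 fun h => hkl ?_)
        exact T.equivFin.symm.injective (Subtype.ext h))
    have h2 := (h1.precomp T.equivFin.injective).comp
      (fun (c : T) (z : ℝ≥0∞) => (c : ℝ) * z.toReal) (fun c => by fun_prop)
    simpa [Function.comp_def] using h2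
  have hX_mgf : ∀ c : T, mgf (X c) μ 1 =
      Real.exp (Λ.real (φ ⁻¹' {(c : ℝ)}) * (Real.exp c - 1)) := by
    intro c
    rw [show X c = fun s => (c : ℝ) * N c s from rfl, mgf_const_mul, mul_one]
    exact hx.mgf_count (hB c) (hφ c (hT0 c)) c
  have hX_int : ∀ c : T, Integrable (fun s => Real.exp (1 * X c s)) μ := by
    intro c
    -- `mgf` takes the default value `0` when the exponential is not integrable, whereas its value
    -- here is positive.
    by_contra h
    have h1 := hX_mgf c
    rw [mgf_undef h] at h1
    exact (Real.exp_pos _).ne h1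
  have hsum : ∀ᵐ s ∂μ, ∑' i, φ (x i s) = (∑ c, X c) s := by
    have h1 : ∀ᵐ s ∂μ, ∀ c : T, pointMeasure (fun i => x i s) (φ ⁻¹' {(c : ℝ)}) ≠ ∞ :=
      ae_all_iff.2 fun c => hx.ae_count_ne_top (hB c) (hφ c (hT0 c))
    filter_upwards [h1] with s hs
    have hval : ∀ i, φ (x i s) = ∑ c ∈ T, c * (φ ⁻¹' {c}).indicator (fun _ => (1 : ℝ)) (x i s) :=
      fun i => simpleFunc_comp_eq_sum φ (h := id) rfl (x i s)
    simp_rw [hval]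
    have h2 : HasSum (fun i => ∑ c ∈ T, c * (φ ⁻¹' {c}).indicator (fun _ => (1 : ℝ)) (x i s))
        (∑ c ∈ T, c * N c s) := hasSum_sum fun c hc =>
      (hasSum_indicator_pointMeasure (hB c) (hs ⟨c, hc⟩)).mul_left c
    rw [h2.tsum_eq, Finset.sum_apply, ← Finset.sum_coe_sort]
  have hexp : (fun s => Real.exp (∑' i, φ (x i s))) =ᵐ[μ]
      fun s => Real.exp (1 * (∑ c, X c) s) := by
    filter_upwards [hsum] with s hs
    rw [hs, one_mul]
  refine ⟨(hX_indep.integrable_exp_mul_sum hX_meas fun c _ => hX_int c).congr hexp.symm, ?_⟩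
  rw [integral_congr_ae hexp]
  have h3 := hX_indep.mgf_sum (t := 1) hX_meas Finset.univ
  rw [mgf] at h3
  rw [h3]
  simp_rw [hX_mgf]
  rw [← Real.exp_sum, Finset.sum_coe_sort T
    (fun c => Λ.real (φ ⁻¹' {c}) * (Real.exp c - 1))]
  simp_rw [fun y => simpleFunc_comp_eq_sum φ (h := fun c => Real.exp c - 1) (by simp) y, ← hT]
  have hne : ∀ c ∈ T, Λ (φ ⁻¹' {c}) < ∞ := fun c hc => hφ c (Finset.ne_of_mem_erase hc)
  rw [integral_finsetSum]
  · congr 1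
    refine Finset.sum_congr rfl fun c hc => ?_
    rw [integral_const_mul, integral_indicator (hB c)]
    simp [mul_comm]
  · intro c hc
    refine Integrable.const_mul ?_ _
    exact (integrable_indicator_iff (hB c)).2 (integrableOn_const (hne c hc).ne)

/-- The exponential functional of a Poisson point process. -/
theorem IsPoissonPointProcess.integral_exp_tsum [IsProbabilityMeasure μ] [SigmaFinite Λ]
    (hx : IsPoissonPointProcess Λ x μ) {φ : E → ℝ} (hm : Measurable φ) (hφ : Integrable φ Λ)
    {C : ℝ} (hC : ∀ y, |φ y| ≤ C) :
    Integrable (fun s => Real.exp (∑' i, φ (x i s))) μ ∧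
    ∫ s, Real.exp (∑' i, φ (x i s)) ∂μ = Real.exp (∫ y, (Real.exp (φ y) - 1) ∂Λ) := by
  -- These approximations satisfy `|A f n| ≤ 2 |f|`, the source of every factor `2` below.
  let A : (f : E → ℝ) → Measurable f → ℕ → SimpleFunc E ℝ := fun f hf n =>
    SimpleFunc.approxOn f hf Set.univ 0 (Set.mem_univ 0) n
  have hA_le : ∀ f (hf : Measurable f) n y, |A f hf n y| ≤ 2 * |f y| := fun f hf n y => by
    have := SimpleFunc.norm_approxOn_zero_le hf (Set.mem_univ 0) y n
    rw [two_mul]; exact this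
  have hA_tendsto : ∀ f (hf : Measurable f) y,
      Tendsto (fun n => A f hf n y) atTop (𝓝 (f y)) := fun f hf y =>
    SimpleFunc.tendsto_approxOn hf _ (by simp)
  have hA_fin : ∀ f (hf : Measurable f), Integrable f Λ → ∀ n, ∀ c ≠ 0,
      Λ (A f hf n ⁻¹' {c}) < ∞ := by
    intro f hf hi n c hc
    have h1 : Integrable (A f hf n) Λ := (hi.abs.const_mul 2).mono'
      (A f hf n).aestronglyMeasurable (Eventually.of_forall (hA_le f hf n))
    exact (SimpleFunc.integrable_iff.1 h1) c hc
  have hA_sum : ∀ f (hf : Measurable f), Integrable f Λ → ∀ᵐ s ∂μ,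
      Tendsto (fun n => ∑' i, A f hf n (x i s)) atTop (𝓝 (∑' i, f (x i s))) := by
    intro f hf hi
    filter_upwards [hx.ae_summable hf hi] with s hs
    exact tendsto_tsum_of_dominated_convergence (hs.mul_left 2)
      (fun i => hA_tendsto f hf _) (Eventually.of_forall fun n i => hA_le f hf n _)
  have hA_int : ∀ f (hf : Measurable f), Integrable f Λ → ∀ D, (∀ y, |f y| ≤ D) →
      Tendsto (fun n => ∫ y, (Real.exp (A f hf n y) - 1) ∂Λ) atTop
        (𝓝 (∫ y, (Real.exp (f y) - 1) ∂Λ)) := by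
    intro f hf hi D hD
    refine tendsto_integral_of_dominated_convergence
      (fun y => Real.exp (2 * D) * (2 * |f y|)) (fun n => ?_) ((hi.abs.const_mul 2).const_mul _)
      (fun n => Eventually.of_forall fun y => ?_) (Eventually.of_forall fun y => ?_)
    · exact ((Real.measurable_exp.comp (A f hf n).measurable).sub_const 1).aestronglyMeasurable
    · refine (abs_exp_sub_one_le_mul_abs (C := 2 * D) ((hA_le f hf n y).trans ?_)).trans ?_
      · linarith [hD y]
      · exact mul_le_mul_of_nonneg_left (hA_le f hf n y) (Real.exp_pos _).le
    · exact ((Real.continuous_exp.tendsto _).comp (hA_tendsto f hf y)).sub_const 1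
  -- Integrability comes from Fatou: the expectations for the approximants converge, hence are
  -- bounded. A general `f` is allowed because `2 |φ|` is needed as well as `φ`, to dominate all
  -- approximants at once.
  have key : ∀ f (_ : Measurable f), Integrable f Λ → ∀ D, (∀ y, |f y| ≤ D) →
      Integrable (fun s => Real.exp (∑' i, f (x i s))) μ := by
    intro f hf hi D hD
    have hlim := (Real.continuous_exp.tendsto _).comp (hA_int f hf hi D hD)
    obtain ⟨K, hK⟩ := hlim.bddAbove_range
    refine integrable_of_tendsto_of_integral_le (K := K)
      (fun n => (hx.integral_exp_tsum_simpleFunc (A f hf n) (hA_fin f hf hi n)).1)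
      (fun n => Eventually.of_forall fun s => (Real.exp_pos _).le) (fun n => ?_) ?_
    · rw [(hx.integral_exp_tsum_simpleFunc (A f hf n) (hA_fin f hf hi n)).2]
      exact hK ⟨n, rfl⟩
    · filter_upwards [hA_sum f hf hi] with s hs
      exact (Real.continuous_exp.tendsto _).comp hs
  refine ⟨key φ hm hφ C hC, ?_⟩
  have hdom := key (fun y => 2 * |φ y|) (by fun_prop) (hφ.abs.const_mul 2) (2 * C) (fun y => by
    rw [abs_of_nonneg (by positivity)]; linarith [hC y])
  refine tendsto_nhds_unique (f := fun n => ∫ s, Real.exp (∑' i, A φ hm n (x i s)) ∂μ)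
    (l := atTop) ?_ ?_
  · refine tendsto_integral_of_dominated_convergence _ (fun n =>
      (hx.integral_exp_tsum_simpleFunc (A φ hm n) (hA_fin φ hm hφ n)).1.aestronglyMeasurable)
      hdom (fun n => ?_) ?_
    · filter_upwards [hx.ae_summable hm hφ] with s hs
      rw [Real.norm_of_nonneg (Real.exp_pos _).le, Real.exp_le_exp]
      have h1 : Summable fun i => A φ hm n (x i s) :=
        Summable.of_norm_bounded (hs.mul_left 2) fun i => hA_le φ hm n _
      exact h1.tsum_le_tsum (fun i => (le_abs_self _).trans (hA_le φ hm n _)) (hs.mul_left 2)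
    · filter_upwards [hA_sum φ hm hφ] with s hs
      exact (Real.continuous_exp.tendsto _).comp hs
  · simp_rw [fun n => (hx.integral_exp_tsum_simpleFunc (A φ hm n) (hA_fin φ hm hφ n)).2]
    exact (Real.continuous_exp.tendsto _).comp (hA_int φ hm hφ C hC)

end Poisson

/-! ### Independent marks -/

section Marked

variable {S E : Type*} [MeasurableSpace S] [MeasurableSpace E] {Λ : Measure E}
  {x : ℕ → S → E} {μ : Measure S} {G : S → ℝ} {g : ℕ → S → ℝ} {δ K : ℝ} {v : E → ℝ}

lemma measurable_cgf [SFinite μ] (hG : Measurable G) : Measurable (cgf G μ) := by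
  have h : StronglyMeasurable fun t => ∫ s, Real.exp (t * G s) ∂μ :=
    StronglyMeasurable.integral_prod_right (f := fun t s => Real.exp (t * G s))
      (by fun_prop : Measurable fun p : ℝ × S => Real.exp (p.1 * G p.2)).stronglyMeasurable
  exact Real.measurable_log.comp h.measurable

/-- Shot noise of a marked Poisson point process with integrable marks converges. -/
lemma IsPoissonPointProcess.ae_summable_marked [IsProbabilityMeasure μ] [SigmaFinite Λ]
    (hx : IsPoissonPointProcess Λ x μ) (hG : Integrable G μ)
    (hg : ∀ i, Measurable (g i)) (hg_ident : ∀ i, IdentDistrib (g i) G μ μ)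
    (hxg : IndepFun (fun s i => x i s) (fun s i => g i s) μ)
    (hv : Measurable v) (hvi : Integrable v Λ) :
    ∀ᵐ s ∂μ, Summable fun i => |g i s * v (x i s)| := by
  have h1 : ∀ i, ∫⁻ s, ‖g i s * v (x i s)‖ₑ ∂μ =
      (∫⁻ s, ‖G s‖ₑ ∂μ) * ∫⁻ s, ‖v (x i s)‖ₑ ∂μ := by
    intro i
    have hm1 : Measurable fun s => ‖g i s‖ₑ := (hg i).enorm
    have hm2 : Measurable fun s => ‖v (x i s)‖ₑ := (hv.comp (hx.measurable i)).enorm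
    have hind : IndepFun (fun s => ‖g i s‖ₑ) (fun s => ‖v (x i s)‖ₑ) μ :=
      (hxg.comp (φ := fun x' : ℕ → E => ‖v (x' i)‖ₑ) (ψ := fun g' : ℕ → ℝ => ‖g' i‖ₑ)
        (by fun_prop) (by fun_prop)).symm
    have h2 := lintegral_mul_eq_lintegral_mul_lintegral_of_indepFun hm1 hm2 hind
    simp_rw [enorm_mul]
    refine h2.trans ?_
    congr 1
    exact ((hg_ident i).comp measurable_enorm).lintegral_eq
  have h : ∫⁻ s, ∑' i, ‖g i s * v (x i s)‖ₑ ∂μ ≠ ∞ := by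
    rw [MeasureTheory.lintegral_tsum (f := fun i s => ‖g i s * v (x i s)‖ₑ) fun i =>
      ((hg i).mul (hv.comp (hx.measurable i))).enorm.aemeasurable]
    simp_rw [h1]
    rw [ENNReal.tsum_mul_left, hx.lintegral_tsum (f := fun y => ‖v y‖ₑ) hv.enorm]
    exact ENNReal.mul_ne_top hG.2.ne hvi.2.ne
  filter_upwards [ae_lt_top' (AEMeasurable.tsum fun i =>
    ((hg i).mul (hv.comp (hx.measurable i))).enorm.aemeasurable) h] with s hs
  have := ENNReal.summable_toReal hs.ne
  simpa using this

/-- The case of frozen points, where the factors are independent. The form with `∫⁻` lets Tonelli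
apply afterwards without prior integrability. -/
lemma lintegral_exp_sum_range [IsProbabilityMeasure μ]
    (hint : ∀ t, |t| ≤ δ → Integrable (fun s => Real.exp (t * G s)) μ)
    (hg : ∀ i, Measurable (g i)) (hg_ident : ∀ i, IdentDistrib (g i) G μ μ)
    (hg_indep : iIndepFun g μ) (n : ℕ) (c : ℕ → ℝ) (hc : ∀ i, |c i| ≤ δ) :
    ∫⁻ s, ENNReal.ofReal (Real.exp (∑ i ∈ Finset.range n, g i s * c i)) ∂μ =
      ENNReal.ofReal (Real.exp (∑ i ∈ Finset.range n, cgf G μ (c i))) := by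
  let X : ℕ → S → ℝ := fun i s => c i * g i s
  have hX_meas : ∀ i, Measurable (X i) := fun i => (hg i).const_mul _
  have hX_indep : iIndepFun X μ :=
    hg_indep.comp (fun i z => c i * z) (fun i => by fun_prop)
  have hX_mgf : ∀ i, mgf (X i) μ 1 = Real.exp (cgf G μ (c i)) := by
    intro i
    rw [exp_cgf (hint _ (hc i)), show X i = fun s => c i * g i s from rfl, mgf_const_mul, mul_one,
      mgf_congr_of_identDistrib _ _ (hg_ident i)]
  have hX_int : ∀ i, Integrable (fun s => Real.exp (1 * X i s)) μ := by
    intro i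
    by_contra h
    have h1 := hX_mgf i
    rw [mgf_undef h] at h1
    exact (Real.exp_pos _).ne h1
  have h1 := hX_indep.integrable_exp_mul_sum hX_meas (s := Finset.range n) fun i _ => hX_int i
  have h2 := hX_indep.mgf_sum (t := 1) hX_meas (Finset.range n)
  rw [Real.exp_sum, ← Finset.prod_congr rfl fun i _ => hX_mgf i, ← h2, mgf,
    ofReal_integral_eq_lintegral_ofReal h1 (Eventually.of_forall fun s => (Real.exp_pos _).le)]
  simp [X, mul_comm]

/-- Conditionally on the points, the marks are integrated out. -/
lemma lintegral_exp_sum_range_marked [IsProbabilityMeasure μ] (hx : ∀ i, Measurable (x i))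
    (hG : Measurable G) (hint : ∀ t, |t| ≤ δ → Integrable (fun s => Real.exp (t * G s)) μ)
    (hg : ∀ i, Measurable (g i)) (hg_ident : ∀ i, IdentDistrib (g i) G μ μ)
    (hg_indep : iIndepFun g μ) (hxg : IndepFun (fun s i => x i s) (fun s i => g i s) μ)
    (hv : Measurable v) (hvδ : ∀ y, |v y| ≤ δ) (n : ℕ) :
    ∫⁻ s, ENNReal.ofReal (Real.exp (∑ i ∈ Finset.range n, g i s * v (x i s))) ∂μ =
      ∫⁻ s, ENNReal.ofReal (Real.exp (∑ i ∈ Finset.range n, cgf G μ (v (x i s)))) ∂μ := by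
  have hx' : Measurable fun s i => x i s := measurable_pi_lambda _ hx
  have hg' : Measurable fun s i => g i s := measurable_pi_lambda _ hg
  have hprod := hxg.map_prod_eq_prod_map_map hx'.aemeasurable hg'.aemeasurable
  have : IsProbabilityMeasure (μ.map fun s i => g i s) :=
    Measure.isProbabilityMeasure_map hg'.aemeasurable
  let F : (ℕ → E) × (ℕ → ℝ) → ℝ≥0∞ := fun p =>
    ENNReal.ofReal (Real.exp (∑ i ∈ Finset.range n, p.2 i * v (p.1 i)))
  have hF : Measurable F := by fun_prop
  have hcgf := measurable_cgf (μ := μ) hG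
  calc ∫⁻ s, ENNReal.ofReal (Real.exp (∑ i ∈ Finset.range n, g i s * v (x i s))) ∂μ
      = ∫⁻ p, F p ∂(μ.map fun s => ((fun i => x i s), (fun i => g i s))) :=
        (lintegral_map hF (hx'.prodMk hg')).symm
    _ = ∫⁻ x', ∫⁻ g', F (x', g') ∂(μ.map fun s i => g i s) ∂(μ.map fun s i => x i s) := by
        rw [hprod, lintegral_prod _ hF.aemeasurable]
    _ = ∫⁻ x', ENNReal.ofReal (Real.exp (∑ i ∈ Finset.range n, cgf G μ (v (x' i))))
          ∂(μ.map fun s i => x i s) := by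
        refine lintegral_congr fun x' => ?_
        rw [lintegral_map (f := fun g' => F (x', g')) (hF.comp measurable_prodMk_left) hg']
        exact lintegral_exp_sum_range hint hg hg_ident hg_indep n _ fun i => hvδ _
    _ = _ := lintegral_map (by fun_prop) hx'

/-- The exponential functional of a marked Poisson point process. -/
theorem IsPoissonPointProcess.integral_exp_tsum_marked [IsProbabilityMeasure μ] [SigmaFinite Λ]
    (hx : IsPoissonPointProcess Λ x μ) (hG : Measurable G) (hGi : Integrable G μ)
    (hG_nonneg : 0 ≤ᵐ[μ] G) (hint : ∀ t, |t| ≤ δ → Integrable (fun s => Real.exp (t * G s)) μ)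
    (hK : ∀ t, |t| ≤ δ → |cgf G μ t| ≤ K * |t|)
    (hg : ∀ i, Measurable (g i)) (hg_ident : ∀ i, IdentDistrib (g i) G μ μ)
    (hg_indep : iIndepFun g μ) (hxg : IndepFun (fun s i => x i s) (fun s i => g i s) μ)
    (hv : Measurable v) (hvi : Integrable v Λ) (hvδ : ∀ y, |v y| ≤ δ) :
    Integrable (fun s => Real.exp (∑' i, g i s * v (x i s))) μ ∧
    ∫ s, Real.exp (∑' i, g i s * v (x i s)) ∂μ =
      Real.exp (∫ y, (mgf G μ (v y) - 1) ∂Λ) := by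
  have hcgf := measurable_cgf (μ := μ) hG
  have hg_nonneg : ∀ᵐ s ∂μ, ∀ i, 0 ≤ g i s := ae_all_iff.2 fun i =>
    (hg_ident i).symm.ae_mem_snd (t := Set.Ici 0) measurableSet_Ici hG_nonneg
  have hK0 : ∀ u : E → ℝ, (∀ y, |u y| ≤ δ) → ∀ y, |cgf G μ (u y)| ≤ |K| * |u y| := fun u hu y =>
    (hK _ (hu y)).trans (mul_le_mul_of_nonneg_right (le_abs_self K) (abs_nonneg _))
  have hφi : ∀ u : E → ℝ, Measurable u → Integrable u Λ → (∀ y, |u y| ≤ δ) →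
      Integrable (fun y => cgf G μ (u y)) Λ := fun u hu hui hδ =>
    (hui.abs.const_mul |K|).mono' (hcgf.comp hu).aestronglyMeasurable
      (Eventually.of_forall (hK0 u hδ))
  have hφb : ∀ u : E → ℝ, (∀ y, |u y| ≤ δ) → ∀ y, |cgf G μ (u y)| ≤ |K| * δ := fun u hδ y =>
    (hK0 u hδ y).trans (mul_le_mul_of_nonneg_left (hδ y) (abs_nonneg K))
  have hdom : ∀ u : E → ℝ, Measurable u → Integrable u Λ → (∀ y, |u y| ≤ δ) →
      Integrable (fun s => Real.exp (∑' i, |cgf G μ (u (x i s))|)) μ := fun u hu hui hδ =>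
    (hx.integral_exp_tsum (φ := fun y => |cgf G μ (u y)|) (by fun_prop) (hφi u hu hui hδ).abs
      (C := |K| * δ) (fun y => by rw [abs_abs]; exact hφb u hδ y)).1
  have hmeas1 : ∀ u : E → ℝ, Measurable u → ∀ n, Measurable fun s =>
      Real.exp (∑ i ∈ Finset.range n, cgf G μ (u (x i s))) := fun u hu n =>
    Real.measurable_exp.comp (Finset.measurable_sum _ fun i _ =>
      hcgf.comp (hu.comp (hx.measurable i)))
  have hmeas2 : ∀ u : E → ℝ, Measurable u → ∀ n, Measurable fun s =>
      Real.exp (∑ i ∈ Finset.range n, g i s * u (x i s)) := fun u hu n =>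
    Real.measurable_exp.comp (Finset.measurable_sum _ fun i _ =>
      (hg i).mul (hu.comp (hx.measurable i)))
  have hle : ∀ u : E → ℝ, Measurable u → Integrable u Λ → (∀ y, |u y| ≤ δ) → ∀ n, ∀ᵐ s ∂μ,
      ‖Real.exp (∑ i ∈ Finset.range n, cgf G μ (u (x i s)))‖ ≤
        Real.exp (∑' i, |cgf G μ (u (x i s))|) := by
    intro u hu hui hδ n
    filter_upwards [hx.ae_summable (hcgf.comp hu) (hφi u hu hui hδ)] with s hs
    rw [Real.norm_of_nonneg (Real.exp_pos _).le, Real.exp_le_exp]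
    exact (Finset.sum_le_sum fun i _ => le_abs_self _).trans
      (hs.sum_le_tsum _ fun i _ => abs_nonneg _)
  have hint1 : ∀ u : E → ℝ, Measurable u → Integrable u Λ → (∀ y, |u y| ≤ δ) → ∀ n,
      Integrable (fun s => Real.exp (∑ i ∈ Finset.range n, cgf G μ (u (x i s)))) μ :=
    fun u hu hui hδ n => (hdom u hu hui hδ).mono' (hmeas1 u hu n).aestronglyMeasurable
      (hle u hu hui hδ n)
  have hint2 : ∀ u : E → ℝ, Measurable u → Integrable u Λ → (∀ y, |u y| ≤ δ) → ∀ n,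
      Integrable (fun s => Real.exp (∑ i ∈ Finset.range n, g i s * u (x i s))) μ := by
    intro u hu hui hδ n
    refine ⟨(hmeas2 u hu n).aestronglyMeasurable, ?_⟩
    rw [hasFiniteIntegral_iff_ofReal (Eventually.of_forall fun s => (Real.exp_pos _).le),
      lintegral_exp_sum_range_marked hx.measurable hG hint hg hg_ident hg_indep hxg hu hδ,
      ← hasFiniteIntegral_iff_ofReal (Eventually.of_forall fun s => (Real.exp_pos _).le)]
    exact (hint1 u hu hui hδ n).2
  have heq : ∀ u : E → ℝ, Measurable u → (∀ y, |u y| ≤ δ) → ∀ n,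
      ∫ s, Real.exp (∑ i ∈ Finset.range n, g i s * u (x i s)) ∂μ =
        ∫ s, Real.exp (∑ i ∈ Finset.range n, cgf G μ (u (x i s))) ∂μ := by
    intro u hu hδ n
    rw [integral_eq_lintegral_of_nonneg_ae (Eventually.of_forall fun s => (Real.exp_pos _).le)
        (hmeas2 u hu n).aestronglyMeasurable,
      integral_eq_lintegral_of_nonneg_ae (Eventually.of_forall fun s => (Real.exp_pos _).le)
        (hmeas1 u hu n).aestronglyMeasurable,
      lintegral_exp_sum_range_marked hx.measurable hG hint hg hg_ident hg_indep hxg hu hδ]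
  have hlim : ∀ u : E → ℝ, Measurable u → Integrable u Λ → ∀ᵐ s ∂μ,
      Tendsto (fun n => Real.exp (∑ i ∈ Finset.range n, g i s * u (x i s))) atTop
        (𝓝 (Real.exp (∑' i, g i s * u (x i s)))) := by
    intro u hu hui
    filter_upwards [hx.ae_summable_marked hGi hg hg_ident hxg hu hui] with s hs
    exact (Real.continuous_exp.tendsto _).comp hs.of_abs.hasSum.tendsto_sum_nat
  -- Fatou again, now along partial sums: their expectations equal those with the marks integrated
  -- out, which are uniformly bounded.
  have key : ∀ u : E → ℝ, Measurable u → Integrable u Λ → (∀ y, |u y| ≤ δ) →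
      Integrable (fun s => Real.exp (∑' i, g i s * u (x i s))) μ := by
    intro u hu hui hδ
    refine integrable_of_tendsto_of_integral_le
      (K := ∫ s, Real.exp (∑' i, |cgf G μ (u (x i s))|) ∂μ) (hint2 u hu hui hδ)
      (fun n => Eventually.of_forall fun s => (Real.exp_pos _).le) (fun n => ?_) (hlim u hu hui)
    rw [heq u hu hδ n]
    refine integral_mono_ae (hint1 u hu hui hδ n) (hdom u hu hui hδ) ?_
    filter_upwards [hle u hu hui hδ n] with s hs
    exact (le_abs_self _).trans hs
  refine ⟨key v hv hvi hvδ, ?_⟩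
  have h1 : Tendsto (fun n => ∫ s, Real.exp (∑ i ∈ Finset.range n, g i s * v (x i s)) ∂μ) atTop
      (𝓝 (∫ s, Real.exp (∑' i, g i s * v (x i s)) ∂μ)) := by
    -- Since the marks are nonnegative, every partial sum is at most `∑ g_i |v(x_i)|`, whose
    -- exponential is integrable by `key` for `|v|`.
    refine tendsto_integral_of_dominated_convergence _
      (fun n => (hmeas2 v hv n).aestronglyMeasurable)
      (key (fun y => |v y|) (by fun_prop) hvi.abs (fun y => by rw [abs_abs]; exact hvδ y))
      (fun n => ?_) (hlim v hv hvi)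
    filter_upwards [hx.ae_summable_marked hGi hg hg_ident hxg hv hvi, hg_nonneg] with s hs hs0
    rw [Real.norm_of_nonneg (Real.exp_pos _).le, Real.exp_le_exp]
    have h2 : ∀ i, |g i s * v (x i s)| = g i s * |v (x i s)| := fun i => by
      rw [abs_mul, abs_of_nonneg (hs0 i)]
    simp_rw [h2] at hs
    exact (Finset.sum_le_sum fun i _ => mul_le_mul_of_nonneg_left (le_abs_self _) (hs0 i)).trans
      (hs.sum_le_tsum _ fun i _ => mul_nonneg (hs0 i) (abs_nonneg _))
  have h2 : Tendsto (fun n => ∫ s, Real.exp (∑ i ∈ Finset.range n, cgf G μ (v (x i s))) ∂μ) atTop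
      (𝓝 (∫ s, Real.exp (∑' i, cgf G μ (v (x i s))) ∂μ)) := by
    refine tendsto_integral_of_dominated_convergence _
      (fun n => (hmeas1 v hv n).aestronglyMeasurable) (hdom v hv hvi hvδ)
      (hle v hv hvi hvδ) ?_
    filter_upwards [hx.ae_summable (hcgf.comp hv) (hφi v hv hvi hvδ)] with s hs
    exact (Real.continuous_exp.tendsto _).comp hs.of_abs.hasSum.tendsto_sum_nat
  simp_rw [heq v hv hvδ] at h1
  rw [tendsto_nhds_unique h1 h2, (hx.integral_exp_tsum (φ := fun y => cgf G μ (v y))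
    (hcgf.comp hv) (hφi v hv hvi hvδ) (hφb v hvδ)).2]
  congr 1
  exact integral_congr_ae (Eventually.of_forall fun y => by
    simp only [exp_cgf (hint _ (hvδ y))])

end Marked

/-! ### Power series -/

/-- By uniqueness of power series, the coefficients `c` are the Taylor coefficients. -/
lemma analyticAt_zero_and_iteratedDeriv_of_hasSum {f : ℝ → ℝ} {c : ℕ → ℝ}
    (h : ∀ᶠ t in 𝓝 (0 : ℝ), HasSum (fun n => t ^ n * c n) (f t)) :
    AnalyticAt ℝ f 0 ∧ ∀ n, iteratedDeriv n f 0 = n.factorial * c n := by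
  have h1 : HasFPowerSeriesAt f (FormalMultilinearSeries.ofScalars ℝ c) 0 := by
    rw [hasFPowerSeriesAt_iff]
    filter_upwards [h] with t ht
    simpa using ht
  refine ⟨h1.analyticAt, fun n => ?_⟩
  have h2 := h1.analyticAt.hasFPowerSeriesAt.eq_formalMultilinearSeries h1
  have h3 := congrArg (fun p => p.coeff n) h2
  simp only [FormalMultilinearSeries.coeff_ofScalars] at h3
  rw [← h3]
  field_simp

/-! ### Moment series integrated against the intensity -/

section Moments

variable {S E : Type*} [MeasurableSpace S] [MeasurableSpace E] {Λ : Measure E} {μ : Measure S}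
  {G : S → ℝ}

lemma zero_mem_interior_integrableExpSet (hG : HasCGF G μ) :
    (0 : ℝ) ∈ interior (integrableExpSet G μ) := by
  rw [mem_interior_iff_mem_nhds]
  have h : Tendsto (fun t : ℝ => -t) (𝓝 0) (𝓝 0) := by
    simpa using (continuous_neg (G := ℝ)).tendsto 0
  filter_upwards [h.eventually hG] with t ht
  simpa [integrableExpSet] using ht

/-- Uniform control of the moment and cumulant generating functions near `0`. -/
lemma exists_forall_abs_le_mgf [IsProbabilityMeasure μ] (hG : HasCGF G μ) :
    ∃ δ > 0, ∃ K : ℝ, ∀ t, |t| ≤ δ → Integrable (fun s => Real.exp (t * G s)) μ ∧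
      |cgf G μ t| ≤ K * |t| ∧
      HasSum (fun n => t ^ n * (moment G n μ / n.factorial)) (mgf G μ t) := by
  have h0 := zero_mem_interior_integrableExpSet hG
  have h1 : ∀ᶠ t in 𝓝 (0 : ℝ), Integrable (fun s => Real.exp (t * G s)) μ :=
    mem_interior_iff_mem_nhds.1 h0
  have h2 : ∀ᶠ t in 𝓝 (0 : ℝ),
      HasSum (fun n => t ^ n * (moment G n μ / n.factorial)) (mgf G μ t) := by
    have := hasFPowerSeriesAt_iff.1 (hasFPowerSeriesAt_mgf h0)
    simpa [moment] using this
  -- The linear bound is differentiability at `0` together with `cgf G μ 0 = 0`.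
  obtain ⟨K, h3⟩ := ((analyticAt_cgf h0).differentiableAt.isBigO_sub).bound
  simp only [cgf_zero, sub_zero, Real.norm_eq_abs] at h3
  obtain ⟨ε, hε, h⟩ := Metric.eventually_nhds_iff.1 (h1.and (h3.and h2))
  refine ⟨ε / 2, by positivity, K, fun t ht => h ?_⟩
  rw [dist_zero_right, Real.norm_eq_abs]
  linarith

/-- Subtracting `1` removes the constant term, which need not be integrable for infinite `Λ`. For `n
≥ 1`, `|w|^n ≤ |w| C^(n-1)`: one factor `|w|` secures integrability, and the rest is summed by the
moment series at `|t| C`. -/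
lemma hasSum_integral_mgf_sub_one [IsProbabilityMeasure μ] {δ C t : ℝ} {w : E → ℝ} (hC : 0 < C)
    (hδ : ∀ t, |t| ≤ δ → HasSum (fun n => t ^ n * (moment G n μ / n.factorial)) (mgf G μ t))
    (hw : Integrable w Λ) (hwC : ∀ y, |w y| ≤ C) (ht : |t| * C ≤ δ) :
    HasSum (fun n : ℕ => t ^ n *
        (if n = 0 then 0 else moment G n μ / n.factorial * ∫ y, w y ^ n ∂Λ))
      (∫ y, (mgf G μ (t * w y) - 1) ∂Λ) := by
  let m : ℕ → ℝ := fun n => moment G n μ / n.factorial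
  let F : ℕ → E → ℝ := fun n y => if n = 0 then 0 else (t * w y) ^ n * m n
  have hF_sum : ∀ y, HasSum (fun n => F n y) (mgf G μ (t * w y) - 1) := by
    intro y
    have h1 := hδ (t * w y) (by
      rw [abs_mul]
      exact (mul_le_mul_of_nonneg_left (hwC y) (abs_nonneg t)).trans ht)
    have h2 := h1.update 0 0
    convert! h2 using 1
    · funext n
      by_cases hn : n = 0
      · simp [F, hn]
      · simp [F, hn, m]
    · simp [moment]
      ring
  have hF_le : ∀ n y, ‖F n y‖ ≤ |w y| * (|(|t| * C) ^ n * m n| / C) := by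
    intro n y
    by_cases hn : n = 0
    · simp only [F, hn, if_true, norm_zero]
      positivity
    · simp only [F, hn, if_false, Real.norm_eq_abs, abs_mul, abs_pow, abs_abs, mul_pow,
        abs_of_pos hC]
      have h1 : |w y| ^ n ≤ |w y| * (C ^ n / C) := by
        have h2 : (|w y| / C) ^ n ≤ |w y| / C :=
          pow_le_of_le_one (by positivity) ((div_le_one hC).2 (hwC y)) hn
        rw [div_pow, div_le_iff₀ (by positivity)] at h2
        calc _ ≤ _ := h2
          _ = _ := by ring
      calc |t| ^ n * |w y| ^ n * |m n| ≤ |t| ^ n * (|w y| * (C ^ n / C)) * |m n| := by gcongr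
        _ = _ := by ring
  have hF_int : ∀ n, Integrable (F n) Λ := by
    intro n
    refine (hw.abs.mul_const _).mono' ?_ (Eventually.of_forall (hF_le n))
    by_cases hn : n = 0
    · simp only [F, hn, if_true]
      exact aestronglyMeasurable_const
    · simp only [F, hn, if_false]
      exact ((hw.aestronglyMeasurable.const_mul t).pow n).mul_const _
  have hF_norm : Summable fun n => ∫ y, ‖F n y‖ ∂Λ := by
    refine Summable.of_nonneg_of_le (fun n => integral_nonneg fun y => norm_nonneg _)
      (f := fun n => (∫ y, |w y| ∂Λ) * (|(|t| * C) ^ n * m n| / C)) (fun n => ?_) ?_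
    · rw [← integral_mul_const]
      exact integral_mono (hF_int n).norm (hw.abs.mul_const _) (hF_le n)
    · refine Summable.mul_left _ (Summable.div_const ?_ _)
      refine (hδ (|t| * C) ?_).summable.abs
      rwa [abs_of_nonneg (by positivity)]
  have h := hasSum_integral_of_summable_integral_norm hF_int hF_norm
  simp_rw [fun y => (hF_sum y).tsum_eq] at h
  refine h.congr_fun fun n => ?_
  by_cases hn : n = 0
  · simp [F, hn]
  · simp only [F, hn, if_false]
    rw [integral_mul_const]
    simp_rw [mul_pow]
    rw [integral_const_mul]
    ring

end Moments

/-! ### Moments of the path loss -/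

/-- Polar coordinates reduce both claims to `z^(1-β)` on `[r, ∞)`; the factor `2π` is the dimension
times the area of the unit disc. -/
lemma integrableOn_and_integral_norm_rpow_plane {r β : ℝ} (hr : 0 < r) (hβ : 2 < β) :
    IntegrableOn (fun y : Plane => ‖y‖ ^ (-β)) {y | r ≤ ‖y‖} ∧
    ∫ y in {y : Plane | r ≤ ‖y‖}, ‖y‖ ^ (-β) = 2 * Real.pi / (β - 2) * r ^ (-β + 2) := by
  have hms : MeasurableSet {y : Plane | r ≤ ‖y‖} := measurableSet_le measurable_const measurable_norm
  let f : ℝ → ℝ := (Set.Ici r).indicator fun z => z ^ (-β)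
  have hf : ({y : Plane | r ≤ ‖y‖}.indicator fun y => ‖y‖ ^ (-β)) = fun y => f ‖y‖ := by
    funext y
    by_cases hy : r ≤ ‖y‖ <;> simp [f, hy]
  have hg : ∀ z ∈ Set.Ioi (0 : ℝ), z ^ (Module.finrank ℝ Plane - 1) • f z =
      (Set.Ici r).indicator (fun z => z ^ (1 - β)) z := by
    intro z hz
    by_cases hz' : r ≤ z
    · have : z ^ (1 - β) = z * z ^ (-β) := by
        rw [sub_eq_add_neg, Real.rpow_add hz, Real.rpow_one]
      simp [f, hz', this]
    · simp [f, hz']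
  have hsub : Set.Ioi (0 : ℝ) ∩ Set.Ici r = Set.Ici r :=
    Set.inter_eq_right.2 fun z hz => hr.trans_le hz
  constructor
  · rw [← integrable_indicator_iff hms, hf, integrable_fun_norm_addHaar,
      integrableOn_congr_fun hg measurableSet_Ioi, integrableOn_indicator_iff measurableSet_Ici,
      Set.inter_comm, hsub, integrableOn_Ici_iff_integrableOn_Ioi]
    exact integrableOn_Ioi_rpow_of_lt (by linarith) hr
  · rw [← integral_indicator hms, hf, integral_fun_norm_addHaar,
      setIntegral_congr_fun measurableSet_Ioi hg, setIntegral_indicator measurableSet_Ici, hsub,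
      integral_Ici_eq_integral_Ioi, integral_Ioi_rpow_of_lt (by linarith) hr]
    have h1 : (volume : Measure Plane).real (Metric.ball 0 1) = Real.pi := by
      simp [Measure.real, Real.pi_pos.le]
    rw [h1, show 1 - β + 1 = -β + 2 by ring]
    have h2 : -β + 2 ≠ 0 := by linarith
    have h3 : β - 2 ≠ 0 := by linarith
    simp only [finrank_euclideanSpace, Fintype.card_fin, smul_eq_mul, nsmul_eq_mul]
    push_cast
    field_simp
    ring

/-- Weight of a base station at `y` in `Ω = θ Y - X`, for a unit channel gain. -/
noncomputable def omegaWeight (a R P α θ : ℝ) (y : Plane) : ℝ :=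
  θ * receivedPower (interfRegion R) P α 1 y - receivedPower (coopRegion a R) P α 1 y

instance sigmaFinite_bsIntensity (lam a : ℝ) : SigmaFinite (bsIntensity lam a) :=
  SMul.sigmaFinite (μ := (volume : Measure Plane).restrict {y | a ≤ ‖y‖}) lam.toNNReal

/-! ### The weight of `Ω` and its power integrals -/

section PathLoss

variable {lam a R P α θ : ℝ}

lemma receivedPower_eq_mul (B : Set Plane) (P α g : ℝ) (y : Plane) :
    receivedPower B P α g y = g * receivedPower B P α 1 y := by
  by_cases hy : y ∈ B <;> simp [receivedPower, hy, mul_assoc]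

lemma measurableSet_interfRegion (R : ℝ) : MeasurableSet (interfRegion R) :=
  measurableSet_le measurable_const measurable_norm

lemma measurableSet_coopRegion (a R : ℝ) : MeasurableSet (coopRegion a R) :=
  (measurableSet_le measurable_const measurable_norm).inter
    (measurableSet_lt measurable_norm measurable_const)

lemma measurable_receivedPower {B : Set Plane} (hB : MeasurableSet B) (P α g : ℝ) :
    Measurable (receivedPower B P α g) :=
  Measurable.indicator (by fun_prop) hB

lemma measurable_omegaWeight (a R P α θ : ℝ) : Measurable (omegaWeight a R P α θ) :=
  ((measurable_receivedPower (measurableSet_interfRegion R) P α 1).const_mul θ).sub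
    (measurable_receivedPower (measurableSet_coopRegion a R) P α 1)

lemma integrable_receivedPower {B : Set Plane} (hB : MeasurableSet B) (ha : 0 < a) (hα : 2 < α) :
    Integrable (receivedPower B P α 1) (bsIntensity lam a) := by
  refine Integrable.smul_measure ?_ ENNReal.ofReal_ne_top
  have h := (integrableOn_and_integral_norm_rpow_plane ha hα).1
  exact (h.const_mul (1 * P)).indicator hB

lemma integrable_omegaWeight (ha : 0 < a) (hα : 2 < α) :
    Integrable (omegaWeight a R P α θ) (bsIntensity lam a) :=
  ((integrable_receivedPower (measurableSet_interfRegion R) ha hα).const_mul θ).sub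
    (integrable_receivedPower (measurableSet_coopRegion a R) ha hα)

lemma abs_receivedPower_le {B : Set Plane} (hB : ∀ y ∈ B, a ≤ ‖y‖) (ha : 0 < a) (hP : 0 < P)
    (hα : 0 < α) (y : Plane) : |receivedPower B P α 1 y| ≤ P * a ^ (-α) := by
  by_cases hy : y ∈ B
  · have h1 : ‖y‖ ^ (-α) ≤ a ^ (-α) :=
      Real.rpow_le_rpow_of_nonpos ha (hB y hy) (by linarith)
    have h2 : 0 ≤ ‖y‖ ^ (-α) := Real.rpow_nonneg (norm_nonneg _) _
    simp only [receivedPower, Set.indicator_of_mem hy, one_mul]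
    rw [abs_of_nonneg (by positivity)]
    gcongr
  · simp only [receivedPower, Set.indicator_of_notMem hy, abs_zero]
    positivity

lemma abs_omegaWeight_le (ha : 0 < a) (haR : a ≤ R) (hP : 0 < P) (hα : 0 < α) (hθ : 0 < θ)
    (y : Plane) : |omegaWeight a R P α θ y| ≤ (θ + 1) * (P * a ^ (-α)) := by
  have h1 := abs_receivedPower_le (B := interfRegion R) (fun z hz => haR.trans hz) ha hP hα y
  have h2 := abs_receivedPower_le (B := coopRegion a R) (fun z hz => hz.1) ha hP hα y
  calc |omegaWeight a R P α θ y| ≤ |θ * receivedPower (interfRegion R) P α 1 y| +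
        |receivedPower (coopRegion a R) P α 1 y| := abs_sub _ _
    _ ≤ θ * (P * a ^ (-α)) + P * a ^ (-α) := by
        rw [abs_mul, abs_of_pos hθ]
        gcongr
    _ = _ := by ring

/-- The useful-signal term is extended to all of `{a ≤ ‖y‖}` and corrected beyond `R`, so that only
integrals over exteriors of discs occur. -/
lemma omegaWeight_pow (n : ℕ) {y : Plane} (hy : a ≤ ‖y‖) :
    omegaWeight a R P α θ y ^ n =
      (θ ^ n - (-1) ^ n) * P ^ n *
        {z : Plane | R ≤ ‖z‖}.indicator (fun z => ‖z‖ ^ (-(n * α))) y +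
      (-1) ^ n * P ^ n * ‖y‖ ^ (-(n * α)) := by
  have h : ‖y‖ ^ (-(n * α)) = (‖y‖ ^ (-α)) ^ n := by
    rw [← Real.rpow_natCast, ← Real.rpow_mul (norm_nonneg _)]
    ring_nf
  by_cases hR : R ≤ ‖y‖
  · have h1 : y ∈ interfRegion R := hR
    have h2 : y ∉ coopRegion a R := fun h' => absurd h'.2 (not_lt.2 hR)
    have h3 : y ∈ {z : Plane | R ≤ ‖z‖} := hR
    simp only [omegaWeight, receivedPower, Set.indicator_of_mem h1, Set.indicator_of_notMem h2,
      Set.indicator_of_mem h3, h]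
    ring
  · have h1 : y ∉ interfRegion R := hR
    have h2 : y ∈ coopRegion a R := ⟨hy, not_le.1 hR⟩
    have h3 : y ∉ {z : Plane | R ≤ ‖z‖} := hR
    simp only [omegaWeight, receivedPower, Set.indicator_of_mem h2, Set.indicator_of_notMem h1,
      Set.indicator_of_notMem h3, h]
    rw [mul_zero, mul_zero, zero_sub, zero_add, neg_pow]
    ring

lemma integral_omegaWeight_pow (hlam : 0 < lam) (ha : 0 < a) (haR : a ≤ R) (hα : 2 < α) {n : ℕ}
    (hn : 1 ≤ n) :
    ∫ y, omegaWeight a R P α θ y ^ n ∂(bsIntensity lam a) =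
      2 * Real.pi * lam * P ^ n / (n * α - 2) *
        ((θ ^ n - (-1) ^ n) * R ^ (-(n : ℝ) * α + 2) + (-1) ^ n * a ^ (-(n : ℝ) * α + 2)) := by
  have hn' : (1 : ℝ) ≤ n := by exact_mod_cast hn
  have hβ : 2 < n * α := by nlinarith
  have hR : 0 < R := ha.trans_le haR
  obtain ⟨ha1, ha2⟩ := integrableOn_and_integral_norm_rpow_plane ha hβ
  obtain ⟨hR1, hR2⟩ := integrableOn_and_integral_norm_rpow_plane hR hβ
  have hms : ∀ r : ℝ, MeasurableSet {y : Plane | r ≤ ‖y‖} := fun r =>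
    measurableSet_le measurable_const measurable_norm
  have hsub : {y : Plane | a ≤ ‖y‖} ∩ {y : Plane | R ≤ ‖y‖} = {y : Plane | R ≤ ‖y‖} :=
    Set.inter_eq_right.2 fun y hy => haR.trans hy
  rw [bsIntensity, integral_smul_measure, ENNReal.toReal_ofReal hlam.le,
    setIntegral_congr_fun (hms a) fun y hy => omegaWeight_pow n hy,
    integral_add (((hR1.integrable_indicator (hms R)).integrableOn).const_mul _)
      (ha1.const_mul _),
    integral_const_mul, integral_const_mul, setIntegral_indicator (hms R), hsub, ha2, hR2,
    smul_eq_mul, neg_mul]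
  ring

end PathLoss

end CoMP

/-! ### The cumulants of `Ω` -/

theorem lemma3 {S : Type*} [MeasurableSpace S] (μ : Measure S) [IsProbabilityMeasure μ]
    (lam a R P α θ : ℝ) (hlam : 0 < lam) (ha : 0 < a) (haR : a ≤ R) (hP : 0 < P) (hα : 2 < α)
    (hθ : 0 < θ)
    -- the positions of the base stations
    (x : ℕ → S → CoMP.Plane) (hx : CoMP.IsPoissonPointProcess (CoMP.bsIntensity lam a) x μ)
    -- the channel gains: i.i.d. copies of `G`, independent of the positions
    (G : S → ℝ) (hG : Measurable G) (hG_nonneg : 0 ≤ᵐ[μ] G) (hG_cgf : CoMP.HasCGF G μ)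
    (g : ℕ → S → ℝ) (hg : ∀ i, Measurable (g i)) (hg_ident : ∀ i, IdentDistrib (g i) G μ μ)
    (hg_indep : iIndepFun g μ) (hxg : IndepFun (fun s i => x i s) (fun s i => g i s) μ) :
    -- the sums that define `X` and `Y` converge almost surely
    (∀ᵐ s ∂μ, Summable fun i =>
      CoMP.receivedPower (CoMP.coopRegion a R) P α (g i s) (x i s)) ∧
    (∀ᵐ s ∂μ, Summable fun i =>
      CoMP.receivedPower (CoMP.interfRegion R) P α (g i s) (x i s)) ∧
    -- the cumulant generating function of `Ω` exists near `0` and has a Taylor expansion there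
    CoMP.HasCGF (CoMP.omegaVar a R P α θ x g) μ ∧
    AnalyticAt ℝ (CoMP.CGF (CoMP.omegaVar a R P α θ x g) μ) 0 ∧
    -- the cumulants of `Ω`
    ∀ n : ℕ, 1 ≤ n →
      CoMP.cumulant n (CoMP.omegaVar a R P α θ x g) μ =
        CoMP.kappaLim n lam P α a (moment G n μ) *
          (1 + ((-θ) ^ n - 1) * (R / a) ^ (-(n : ℝ) * α + 2)) := by
  open CoMP in
  have hR : 0 < R := ha.trans_le haR
  obtain ⟨δ, hδ, K, hGδ⟩ := exists_forall_abs_le_mgf hG_cgf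
  have hGi : Integrable G μ :=
    integrable_of_mem_interior_integrableExpSet (zero_mem_interior_integrableExpSet hG_cgf)
  have hsum : ∀ B, MeasurableSet B → ∀ᵐ s ∂μ, Summable fun i =>
      receivedPower B P α (g i s) (x i s) := by
    intro B hB
    filter_upwards [hx.ae_summable_marked hGi hg hg_ident hxg (measurable_receivedPower hB P α 1)
      (integrable_receivedPower hB ha hα)] with s hs
    simp_rw [fun i => receivedPower_eq_mul B P α (g i s) (x i s)]
    exact hs.of_abs
  have hsumX := hsum _ (measurableSet_coopRegion a R)
  have hsumY := hsum _ (measurableSet_interfRegion R)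
  set w := omegaWeight a R P α θ with hw
  set C := (θ + 1) * (P * a ^ (-α)) with hC
  have hC0 : 0 < C := by positivity
  have hwC : ∀ y, |w y| ≤ C := abs_omegaWeight_le ha haR hP (by linarith) hθ
  have hwi : Integrable w (bsIntensity lam a) := integrable_omegaWeight ha hα
  have hwm : Measurable w := measurable_omegaWeight a R P α θ
  -- Almost sure summability allows the two sums to be merged into one shot noise with weight `-t
  -- w`.
  have hΩ : ∀ᵐ s ∂μ, ∀ t : ℝ,
      ∑' i, g i s * (-t * w (x i s)) = -t * omegaVar a R P α θ x g s := by
    filter_upwards [hsumX, hsumY] with s hX hY t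
    rw [omegaVar, aggregatePower, aggregatePower, ← tsum_mul_left, ← (hY.mul_left θ).tsum_sub hX,
      ← tsum_mul_left]
    refine tsum_congr fun i => ?_
    rw [receivedPower_eq_mul _ P α (g i s), receivedPower_eq_mul (coopRegion a R) P α (g i s), hw,
      omegaWeight]
    ring
  have hnear : ∀ᶠ t in 𝓝 (0 : ℝ), |t| * C ≤ δ := by
    have h : Tendsto (fun t : ℝ => |t| * C) (𝓝 0) (𝓝 0) := by
      simpa using (continuous_abs.mul continuous_const).tendsto (0 : ℝ) (f := fun t : ℝ => |t| * C)
    exact (h.eventually_lt_const hδ).mono fun t ht => ht.le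
  have hmgf : ∀ t, |t| * C ≤ δ →
      Integrable (fun s => Real.exp (-t * omegaVar a R P α θ x g s)) μ ∧
      ∫ s, Real.exp (-t * omegaVar a R P α θ x g s) ∂μ =
        Real.exp (∫ y, (mgf G μ (-t * w y) - 1) ∂(bsIntensity lam a)) := by
    intro t ht
    have h := hx.integral_exp_tsum_marked (v := fun y => -t * w y) hG hGi hG_nonneg
      (fun t ht => (hGδ t ht).1) (fun t ht => (hGδ t ht).2.1) hg hg_ident hg_indep hxg
      (hwm.const_mul _) (hwi.const_mul _) (fun y => by
        rw [abs_mul, abs_neg]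
        exact (mul_le_mul_of_nonneg_left (hwC y) (abs_nonneg t)).trans ht)
    have hae : (fun s => Real.exp (∑' i, g i s * (-t * w (x i s)))) =ᵐ[μ]
        fun s => Real.exp (-t * omegaVar a R P α θ x g s) := by
      filter_upwards [hΩ] with s hs
      rw [hs t]
    exact ⟨h.1.congr hae, by rw [← integral_congr_ae hae, h.2]⟩
  have hseries : ∀ᶠ t in 𝓝 (0 : ℝ), HasSum (fun n : ℕ => t ^ n * ((-1) ^ n *
      (if n = 0 then 0 else moment G n μ / n.factorial * ∫ y, w y ^ n ∂(bsIntensity lam a))))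
      (CGF (omegaVar a R P α θ x g) μ t) := by
    filter_upwards [hnear] with t ht
    rw [CGF, MGF, (hmgf t ht).2, Real.log_exp]
    refine (hasSum_integral_mgf_sub_one (t := -t) hC0 (fun t ht => (hGδ t ht).2.2) hwi hwC
      (by rwa [abs_neg])).congr_fun fun n => ?_
    rw [neg_pow]
    ring
  obtain ⟨hanalytic, hderiv⟩ := analyticAt_zero_and_iteratedDeriv_of_hasSum hseries
  refine ⟨hsumX, hsumY, hnear.mono fun t ht => (hmgf t ht).1, hanalytic, fun n hn => ?_⟩
  have hsq : (-1 : ℝ) ^ n * (-1) ^ n = 1 := by rw [← mul_pow]; simp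
  have hfac : (n.factorial : ℝ) ≠ 0 := by positivity
  have hn0 : n ≠ 0 := by omega
  have hapow : a ^ (-(n : ℝ) * α + 2) ≠ 0 := (Real.rpow_pos_of_pos ha _).ne'
  rw [cumulant, hderiv, if_neg hn0, integral_omegaWeight_pow hlam ha haR hα hn, kappaLim,
    Real.div_rpow hR.le ha.le, neg_pow θ]
  -- What remains is polynomial algebra modulo `e * e = 1`, the only property of the sign that
  -- matters.
  generalize (-1 : ℝ) ^ n = e at *
  generalize a ^ (-(n : ℝ) * α + 2) = A at *
  generalize R ^ (-(n : ℝ) * α + 2) = B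
  have hden : (n : ℝ) * α - 2 ≠ 0 := by
    have hn' : (1 : ℝ) ≤ n := by exact_mod_cast hn
    nlinarith
  field_simp
  linear_combination (moment G n μ * (B * (θ ^ n - e) + e * A) -
    moment G n μ * B * θ ^ n) * hsq
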